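/- Corollary 3.2. There exists a countable simple non-amenable hyperlinear group. There also exists a finitely generated hyperlinear group that is not residually amenable. Here the terms have the following meaning. A group $G$ is amenable if there is a left-invariant finitely additive probability measure defined on all subsets of $G$. It is residually amenable if for every $1\ne g\in G$ there is a normal subgroup $N\lhd G$ with $g\notin N$ such that $G/N$ is amenable. Let $\mathcal M=\bigcup_{k\ge1}\mathrm{Mat}_{k\times k}(\mathbb C)$ be the union of the matrix algebras along the unital embeddings $a\mapsto a\otimes \mathrm{Id}$ of $\mathrm{Mat}_{k\times k}(\mathbb C)$ in $\mathrm{Mat}_{l\times l}(\mathbb C)$ for $k\mid l$, and let $\mathrm{Tr}$ be the trace on $\mathcal M$ given by the normalized traces of the matrix algebras. The hyperfinite factor $R$ is the von Neumann algebra generated by $\mathcal M$ acting by left multiplication on the Hilbert space $L^2(\mathcal M,\mathrm{Tr})$, the completion of $\mathcal M$ for $\langle a,b\rangle=\mathrm{Tr}(a^*b)$; its tracial state is $\mathrm{Tr}_R(T)=\langle \hat 1,T\hat 1\rangle$, where $\hat 1$ is the vector of $1\in\mathcal M$. For an ultrafilter $\omega$ on a set $I$ put $$R^{(I)}=\Big\{(a_i)_{i\in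 I}\in\prod_{i\in I}R\ \Big|\ \sup_{i}\|a_i\|<\infty\Big\},\qquad J_\omega=\Big\{(a_i)\in R^{(I)}\ \Big|\ \lim_\omega \mathrm{Tr}_R(a_ia_i^*)=0\Big\},\qquad R^\omega=R^{(I)}/J_\omega .$$ A countable group $G$ is hyperlinear if for every non-principal ultrafilter $\omega$ on a countable set there is an injective homomorphism from $G$ into the unitary group of $R^\omega$. -/

import Mathlib

open scoped InnerProductSpace Topology

noncomputable section

namespace HyperfiniteFactor

/-- The separable Hilbert space `ℓ²(ℕ)` with its orthonormal basis `e 0, e 1, …`. -/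
abbrev Seq : Type := lp (fun _ : ℕ => ℂ) 2

/-- The standard basis vectors of `ℓ²(ℕ)`. -/
def e (n : ℕ) : Seq := lp.single 2 n (1 : ℂ)

lemma e_apply (n m : ℕ) : (e n : Seq) m = if m = n then 1 else 0 := by
  rw [e, lp.single_apply, Pi.single_apply]

lemma inner_e (n : ℕ) (x : Seq) : ⟪e n, x⟫_ℂ = x n := by
  simp [e, lp.inner_single_left]

lemma ext_e {S T : Seq →L[ℂ] Seq} (h : ∀ n, S (e n) = T (e n)) : S = T := by
  refine lp.ext_continuousLinearMap (by norm_num) fun i => ?_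
  ext1
  exact h i

/-- The contraction `(x_n)_n ↦ (x_{ks+j})_s` of `ℓ²(ℕ)`. -/
def compress (k : ℕ) (j : Fin k) : Seq →L[ℂ] Seq :=
  LinearMap.mkContinuous
    { toFun := fun x => ⟨fun s => x (k * s + j), by
        have hinj : Function.Injective fun s : ℕ => k * s + (j : ℕ) := by
          intro s t h
          have : 0 < k := j.pos
          simpa [this.ne'] using h
        have h := (lp.memℓp x).summable (by norm_num)
        exact memℓp_gen (h.comp_injective hinj)⟩
      map_add' := fun x y => rfl
      map_smul' := fun c x => rfl } 1 (by
    intro x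
    have hinj : Function.Injective fun s : ℕ => k * s + (j : ℕ) := by
      intro s t h
      have : 0 < k := j.pos
      simpa [this.ne'] using h
    have h := (lp.memℓp x).summable (by norm_num)
    rw [one_mul, lp.norm_eq_tsum_rpow (by norm_num), lp.norm_eq_tsum_rpow (by norm_num)]
    refine Real.rpow_le_rpow (tsum_nonneg fun _ => by positivity) ?_ (by norm_num)
    exact tsum_comp_le_tsum_of_inj h (fun _ => by positivity) hinj)

lemma compress_apply (k : ℕ) (j : Fin k) (x : Seq) (s : ℕ) :
    compress k j x s = x (k * s + j) := rfl

lemma adjoint_compress_e (k : ℕ) (j : Fin k) (s : ℕ) :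
    (compress k j).adjoint (e s) = e (k * s + j) := by
  ext n
  rw [← inner_e, ContinuousLinearMap.adjoint_inner_right, ← inner_conj_symm, inner_e,
    compress_apply, e_apply, e_apply]
  simp [eq_comm]

lemma block_eq {k : ℕ} {s t : ℕ} {i j : Fin k} :
    k * s + (i : ℕ) = k * t + j ↔ s = t ∧ i = j := by
  have hk : 0 < k := i.pos
  constructor
  · intro h
    have h1 := congrArg (· / k) h
    have h2 := congrArg (· % k) h
    simp [Nat.mul_add_div hk, Nat.div_eq_of_lt, Nat.mod_eq_of_lt] at h1 h2
    exact ⟨h1, Fin.ext h2⟩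
  · rintro ⟨rfl, rfl⟩; rfl

lemma compress_e (k : ℕ) (i j : Fin k) (s : ℕ) :
    compress k i (e (k * s + j)) = if i = j then e s else 0 := by
  ext t
  rw [compress_apply, e_apply]
  simp only [block_eq]
  by_cases h : i = j <;> simp [h, e_apply]

/-- The embedding of the `k × k` matrices in the bounded operators on `ℓ²(ℕ)`:
`rho k A` maps `e_{ks+j}` to `∑ i, A i j • e_{ks+i}`, see `rho_e`. -/
def rho (k : ℕ) (A : Matrix (Fin k) (Fin k) ℂ) : Seq →L[ℂ] Seq :=
  ∑ i, ∑ j, A i j • ((compress k i).adjoint ∘L compress k j)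

lemma rho_e (k : ℕ) (A : Matrix (Fin k) (Fin k) ℂ) (s : ℕ) (j : Fin k) :
    rho k A (e (k * s + j)) = ∑ i, A i j • e (k * s + i) := by
  simp [rho, compress_e, apply_ite, adjoint_compress_e]

lemma ext_block {k : ℕ} (hk : 0 < k) {S T : Seq →L[ℂ] Seq}
    (h : ∀ (s : ℕ) (j : Fin k), S (e (k * s + j)) = T (e (k * s + j))) : S = T := by
  refine ext_e fun n => ?_
  have := h (n / k) ⟨n % k, Nat.mod_lt _ hk⟩
  simpa [Nat.div_add_mod] using this

lemma rho_add (k : ℕ) (A B : Matrix (Fin k) (Fin k) ℂ) : rho k (A + B) = rho k A + rho k B := by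
  simp [rho, add_smul, Finset.sum_add_distrib]

lemma rho_smul (k : ℕ) (c : ℂ) (A : Matrix (Fin k) (Fin k) ℂ) :
    rho k (c • A) = c • rho k A := by
  simp [rho, Finset.smul_sum, smul_smul]

lemma rho_one {k : ℕ} (hk : 0 < k) : rho k 1 = 1 := by
  refine ext_block hk fun s j => ?_
  simp [rho_e, Matrix.one_apply]

lemma rho_mul {k : ℕ} (hk : 0 < k) (A B : Matrix (Fin k) (Fin k) ℂ) :
    rho k (A * B) = rho k A * rho k B := by
  refine ext_block hk fun s j => ?_
  simp only [rho_e, mul_apply_eq_comp, map_sum, map_smul, Matrix.mul_apply,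
    Finset.smul_sum, Finset.sum_smul, smul_smul]
  rw [Finset.sum_comm]
  simp only [mul_comm]

lemma rho_star (k : ℕ) (A : Matrix (Fin k) (Fin k) ℂ) :
    rho k A.conjTranspose = star (rho k A) := by
  rw [ContinuousLinearMap.star_eq_adjoint]
  simp only [rho, map_sum, map_smulₛₗ, ContinuousLinearMap.adjoint_comp,
    ContinuousLinearMap.adjoint_adjoint, Matrix.conjTranspose_apply]
  rw [Finset.sum_comm]
  rfl

/-- The matrix `A ⊗ 1`. -/
def amplify (k m : ℕ) (A : Matrix (Fin k) (Fin k) ℂ) : Matrix (Fin (m * k)) (Fin (m * k)) ℂ :=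
  Matrix.reindex finProdFinEquiv finProdFinEquiv
    (Matrix.kronecker (1 : Matrix (Fin m) (Fin m) ℂ) A)

lemma amplify_apply (k m : ℕ) (A : Matrix (Fin k) (Fin k) ℂ) (a b : Fin m) (i j : Fin k) :
    amplify k m A (finProdFinEquiv (a, i)) (finProdFinEquiv (b, j))
      = if a = b then A i j else 0 := by
  rw [amplify, Matrix.reindex_apply, Matrix.submatrix_apply, Equiv.symm_apply_apply,
    Equiv.symm_apply_apply]
  simp [Matrix.one_apply]

lemma rho_amplify {k m : ℕ} (hk : 0 < k) (hm : 0 < m) (A : Matrix (Fin k) (Fin k) ℂ) :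
    rho (m * k) (amplify k m A) = rho k A := by
  refine ext_block (Nat.mul_pos hm hk) fun s j => ?_
  obtain ⟨⟨a, b⟩, rfl⟩ := finProdFinEquiv.surjective j
  have key : ∀ (c : Fin m) (d : Fin k), m * k * s + (finProdFinEquiv (c, d) : ℕ)
      = k * (m * s + c) + d := by
    intro c d; simp only [finProdFinEquiv_apply_val]; ring
  rw [rho_e, key, rho_e, ← finProdFinEquiv.sum_comp, Fintype.sum_prod_type]
  simp only [amplify_apply, key]
  rw [Finset.sum_eq_single a]
  · simp
  · intro c _ hc
    simp [hc]
  · simp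

lemma trace_amplify (k m : ℕ) (A : Matrix (Fin k) (Fin k) ℂ) :
    (amplify k m A).trace = m * A.trace := by
  rw [Matrix.trace, ← finProdFinEquiv.sum_comp, Fintype.sum_prod_type]
  simp [Matrix.diag, amplify_apply, Matrix.trace]

lemma exists_common {S T : Seq →L[ℂ] Seq} (hS : ∃ k, 0 < k ∧ ∃ A, rho k A = S)
    (hT : ∃ k, 0 < k ∧ ∃ A, rho k A = T) :
    ∃ k, 0 < k ∧ ∃ A B, rho k A = S ∧ rho k B = T := by
  obtain ⟨k, hk, A, rfl⟩ := hS
  obtain ⟨l, hl, B, rfl⟩ := hT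
  have hB : ∃ B', rho (l * k) B' = rho l B := by
    rw [mul_comm l k]
    exact ⟨amplify l k B, rho_amplify hl hk B⟩
  obtain ⟨B', hB'⟩ := hB
  exact ⟨l * k, Nat.mul_pos hl hk, amplify k l A, B', rho_amplify hk hl A, hB'⟩

/-- The `*`-algebra `⋃ k, rho k (Mat_k ℂ)` of bounded operators on `ℓ²(ℕ)`. -/
def matUnion : StarSubalgebra ℂ (Seq →L[ℂ] Seq) where
  carrier := {T | ∃ k, 0 < k ∧ ∃ A, rho k A = T}
  mul_mem' := by
    intro S T hS hT
    obtain ⟨k, hk, A, B, rfl, rfl⟩ := exists_common hS hT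
    exact ⟨k, hk, A * B, rho_mul hk A B⟩
  add_mem' := by
    intro S T hS hT
    obtain ⟨k, hk, A, B, rfl, rfl⟩ := exists_common hS hT
    exact ⟨k, hk, A + B, rho_add k A B⟩
  algebraMap_mem' := fun c =>
    ⟨1, one_pos, c • 1, by rw [rho_smul, rho_one one_pos, Algebra.algebraMap_eq_smul_one]⟩
  star_mem' := by
    rintro S ⟨k, hk, A, rfl⟩
    exact ⟨k, hk, A.conjTranspose, rho_star k A⟩

lemma rho_mem {k : ℕ} (hk : 0 < k) (A : Matrix (Fin k) (Fin k) ℂ) : rho k A ∈ matUnion :=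
  ⟨k, hk, A, rfl⟩

lemma rho_injective {k : ℕ} : Function.Injective (rho k) := by
  intro A B h
  ext i j
  have := congrArg (fun T : Seq →L[ℂ] Seq => ⟪e (k * 0 + i), T (e (k * 0 + j))⟫_ℂ) h
  simp only [rho_e, inner_sum, inner_smul_right, inner_e, e_apply, block_eq] at this
  simpa using this

/-- The normalized trace of the matrices, on the union of their images. -/
def matTrace (a : matUnion) : ℂ :=
  (a.2.choose_spec.2.choose).trace / (a.2.choose : ℂ)

lemma matTrace_eq {k : ℕ} (hk : 0 < k) (A : Matrix (Fin k) (Fin k) ℂ) (a : matUnion)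
    (ha : rho k A = a) : matTrace a = A.trace / k := by
  have hl : 0 < a.2.choose := a.2.choose_spec.1
  have hB := a.2.choose_spec.2.choose_spec
  rw [matTrace]
  generalize a.2.choose_spec.2.choose = B at hB ⊢
  generalize a.2.choose = l at B hl hB ⊢
  have h1 := rho_amplify hk hl A
  have h2 := rho_amplify hl hk B
  have h3 : (amplify k l A).trace = (amplify l k B).trace := by
    have : ∀ (n m : ℕ) (_ : n = m) (C : Matrix (Fin n) (Fin n) ℂ) (D : Matrix (Fin m) (Fin m) ℂ),
        rho n C = rho m D → C.trace = D.trace := by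
      rintro n _ rfl C D h
      rw [rho_injective h]
    exact this _ _ (mul_comm l k) _ _ (by rw [h1, h2, ha, hB])
  rw [trace_amplify, trace_amplify] at h3
  have hk' : (k : ℂ) ≠ 0 := by exact_mod_cast hk.ne'
  have hl' : (l : ℂ) ≠ 0 := by exact_mod_cast hl.ne'
  field_simp
  linear_combination -h3

lemma exists_rep (a : matUnion) : ∃ k, 0 < k ∧ ∃ A, rho k A = a := a.2

lemma matTrace_add (a b : matUnion) : matTrace (a + b) = matTrace a + matTrace b := by
  obtain ⟨k, hk, A, B, hA, hB⟩ := exists_common a.2 b.2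
  rw [matTrace_eq hk A a hA, matTrace_eq hk B b hB,
    matTrace_eq hk (A + B) (a + b) (by rw [rho_add, hA, hB]; rfl), Matrix.trace_add, add_div]

lemma matTrace_smul (c : ℂ) (a : matUnion) : matTrace (c • a) = c * matTrace a := by
  obtain ⟨k, hk, A, hA⟩ := a.2
  rw [matTrace_eq hk A a hA, matTrace_eq hk (c • A) (c • a) (by rw [rho_smul, hA]; rfl),
    Matrix.trace_smul, smul_eq_mul, mul_div_assoc]

lemma matTrace_star (a : matUnion) : matTrace (star a) = star (matTrace a) := by
  obtain ⟨k, hk, A, hA⟩ := a.2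
  rw [matTrace_eq hk A a hA, matTrace_eq hk A.conjTranspose (star a) (by rw [rho_star, hA]; rfl),
    Matrix.trace_conjTranspose, star_div₀, star_natCast]

lemma matTrace_mul_comm (a b : matUnion) : matTrace (a * b) = matTrace (b * a) := by
  obtain ⟨k, hk, A, B, hA, hB⟩ := exists_common a.2 b.2
  rw [matTrace_eq hk (A * B) (a * b) (by rw [rho_mul hk, hA, hB]; rfl),
    matTrace_eq hk (B * A) (b * a) (by rw [rho_mul hk, hA, hB]; rfl), Matrix.trace_mul_comm]

lemma matTrace_eq_sum {k : ℕ} (hk : 0 < k) (A : Matrix (Fin k) (Fin k) ℂ) (a : matUnion)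
    (ha : rho k A = a) :
    matTrace (star a * a) = ((∑ i : Fin k, ‖a.1 (e i)‖ ^ 2) / k : ℝ) := by
  rw [matTrace_eq hk (A.conjTranspose * A) (star a * a)
    (by rw [rho_mul hk, rho_star, ha]; rfl)]
  push_cast
  congr 1
  refine Finset.sum_congr rfl fun i _ => ?_
  have h1 : (((‖a.1 (e i)‖ ^ 2 : ℝ)) : ℂ) = ⟪e (k * 0 + i), rho k (A.conjTranspose * A)
      (e (k * 0 + i))⟫_ℂ := by
    rw [rho_mul hk, rho_star, ha, ContinuousLinearMap.star_eq_adjoint, mul_apply_eq_comp,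
      ContinuousLinearMap.adjoint_inner_right, inner_self_eq_norm_sq_to_K]
    simp
  have h2 := h1
  rw [rho_e] at h2
  simp only [inner_sum, inner_smul_right, inner_e, e_apply, block_eq] at h2
  push_cast at h2
  rw [h2]
  simp

/-- The underlying vector space of `matUnion`, to be given the inner product
`⟪a, b⟫ = tr (a* b)`. -/
def PreL2 : Type := matUnion

instance : AddCommGroup PreL2 := inferInstanceAs (AddCommGroup matUnion)
instance : Module ℂ PreL2 := inferInstanceAs (Module ℂ matUnion)

/-- The class in `PreL2` of an element of the union of the matrix algebras. -/
def toL2 : matUnion ≃ₗ[ℂ] PreL2 := LinearEquiv.refl ℂ _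

/-- The inner product `⟪a, b⟫ = tr (a* b)`. -/
abbrev preL2Core : PreInnerProductSpace.Core ℂ PreL2 where
  inner a b := matTrace (star (toL2.symm a) * toL2.symm b)
  conj_inner_symm a b := by
    change star (matTrace _) = _
    rw [← matTrace_star, star_mul, star_star]
  re_inner_nonneg a := by
    obtain ⟨k, hk, A, hA⟩ := (toL2.symm a).2
    rw [matTrace_eq_sum hk A _ hA]
    rw [RCLike.re_to_complex, Complex.ofReal_re]
    positivity
  add_left a b c := by rw [map_add, star_add, add_mul, matTrace_add]
  smul_left a b c := by
    rw [map_smul, star_smul, smul_mul_assoc, matTrace_smul]; rfl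

instance : SeminormedAddCommGroup PreL2 :=
  InnerProductSpace.Core.toSeminormedAddCommGroup (c := preL2Core)
instance : InnerProductSpace ℂ PreL2 := InnerProductSpace.ofCore preL2Core

lemma preL2_inner (a b : matUnion) : ⟪toL2 a, toL2 b⟫_ℂ = matTrace (star a * b) := rfl

lemma preL2_norm_sq (a : matUnion) : ((‖toL2 a‖ ^ 2 : ℝ) : ℂ) = matTrace (star a * a) := by
  rw [← preL2_inner, inner_self_eq_norm_sq_to_K]
  simp

lemma preL2_norm_star (a : matUnion) : ‖toL2 (star a)‖ = ‖toL2 a‖ := by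
  have h : ‖toL2 (star a)‖ ^ 2 = ‖toL2 a‖ ^ 2 := by
    apply Complex.ofReal_injective
    rw [preL2_norm_sq, preL2_norm_sq, star_star, matTrace_mul_comm]
  exact (pow_left_inj₀ (norm_nonneg _) (norm_nonneg _) two_ne_zero).1 h

lemma preL2_norm_mul (a b : matUnion) : ‖toL2 (a * b)‖ ≤ ‖a.1‖ * ‖toL2 b‖ := by
  obtain ⟨k, hk, A, B, hA, hB⟩ := exists_common a.2 b.2
  have h1 : ‖toL2 (a * b)‖ ^ 2 = (∑ i : Fin k, ‖(a * b).1 (e i)‖ ^ 2) / k := by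
    apply Complex.ofReal_injective
    rw [preL2_norm_sq, matTrace_eq_sum hk (A * B) _ (by rw [rho_mul hk, hA, hB]; rfl)]
  have h2 : ‖toL2 b‖ ^ 2 = (∑ i : Fin k, ‖b.1 (e i)‖ ^ 2) / k := by
    apply Complex.ofReal_injective
    rw [preL2_norm_sq, matTrace_eq_sum hk B _ hB]
  refine (pow_le_pow_iff_left₀ (norm_nonneg _) (by positivity) two_ne_zero).1 ?_
  rw [mul_pow, h1, h2, mul_div_assoc', Finset.mul_sum]
  gcongr with i
  rw [← mul_pow]
  gcongr
  exact a.1.le_opNorm (b.1 (e i))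

/-- The Hilbert space `L²(tr)` of the trace. -/
abbrev L2 : Type := UniformSpace.Completion PreL2

/-- Left multiplication by `a`, before completion. -/
def preLeft (a : matUnion) : PreL2 →L[ℂ] PreL2 :=
  (toL2.toLinearMap ∘ₗ LinearMap.mulLeft ℂ a ∘ₗ toL2.symm.toLinearMap).mkContinuous ‖a.1‖
    fun x => preL2_norm_mul a (toL2.symm x)

/-- Right multiplication by `a`, before completion. -/
def preRight (a : matUnion) : PreL2 →L[ℂ] PreL2 :=
  (toL2.toLinearMap ∘ₗ LinearMap.mulRight ℂ a ∘ₗ toL2.symm.toLinearMap).mkContinuous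
    ‖(star a).1‖ fun x => by
      have := preL2_norm_mul (star a) (star (toL2.symm x))
      rw [preL2_norm_star, ← star_mul, preL2_norm_star] at this
      exact this

/-- The action of the matrices on `L²(tr)` by left multiplication. -/
def left (a : matUnion) : L2 →L[ℂ] L2 := (preLeft a).completion

/-- The action of the matrices on `L²(tr)` by right multiplication. -/
def right (a : matUnion) : L2 →L[ℂ] L2 := (preRight a).completion

lemma left_coe (a b : matUnion) : left a (toL2 b : L2) = (toL2 (a * b) : L2) := by
  rw [left, ContinuousLinearMap.completion_apply_coe]; rfl

lemma right_coe (a b : matUnion) : right a (toL2 b : L2) = (toL2 (b * a) : L2) := by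
  rw [right, ContinuousLinearMap.completion_apply_coe]; rfl

lemma dense_coe (p : L2 → Prop) (hp : IsClosed {x | p x}) (h : ∀ a : matUnion, p (toL2 a : L2))
    (x : L2) : p x :=
  UniformSpace.Completion.induction_on x hp fun a => h (toL2.symm a)

lemma star_left (a : matUnion) : star (left a) = left (star a) := by
  rw [ContinuousLinearMap.star_eq_adjoint, eq_comm, ContinuousLinearMap.eq_adjoint_iff]
  refine fun x y => UniformSpace.Completion.induction_on₂ x y
    (isClosed_eq (by fun_prop) (by fun_prop)) fun b c => ?_
  obtain ⟨b, rfl⟩ := toL2.surjective b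
  obtain ⟨c, rfl⟩ := toL2.surjective c
  rw [left_coe, left_coe, UniformSpace.Completion.inner_coe, UniformSpace.Completion.inner_coe,
    preL2_inner, preL2_inner, star_mul, star_star, mul_assoc]

lemma adjoint_right (a : matUnion) : (right a).adjoint = right (star a) := by
  rw [eq_comm, ContinuousLinearMap.eq_adjoint_iff]
  refine fun x y => UniformSpace.Completion.induction_on₂ x y
    (isClosed_eq (by fun_prop) (by fun_prop)) fun b c => ?_
  obtain ⟨b, rfl⟩ := toL2.surjective b
  obtain ⟨c, rfl⟩ := toL2.surjective c
  rw [right_coe, right_coe, UniformSpace.Completion.inner_coe, UniformSpace.Completion.inner_coe,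
    preL2_inner, preL2_inner, star_mul, star_star, mul_assoc, matTrace_mul_comm, mul_assoc]

lemma left_mul_right (a b : matUnion) : left a * right b = right b * left a := by
  ext x
  refine dense_coe (fun x => (left a * right b) x = (right b * left a) x)
    (isClosed_eq (by fun_prop) (by fun_prop)) (fun c => ?_) x
  simp only [mul_apply_eq_comp, left_coe, right_coe, mul_assoc]

/-- The hyperfinite factor `R`: the von Neumann algebra generated by the matrices
acting on `L²(tr)`, that is, their double commutant (equivalently, their ultraweak closure).
The representation on `L²(tr)`, not the one on `ℓ²(ℕ)`, is the one in which the trace extends. -/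
def R : VonNeumannAlgebra L2 where
  toStarSubalgebra := StarSubalgebra.centralizer ℂ
    (StarSubalgebra.centralizer ℂ (Set.range left) : Set (L2 →L[ℂ] L2))
  centralizer_centralizer' := by
    simp

/-- The hyperfinite factor as a `*`-algebra. -/
abbrev RAlg : Type := R.toStarSubalgebra

lemma right_comm (T : RAlg) (a : matUnion) : right a * T.1 = T.1 * right a := by
  have hT : T.1 ∈ StarSubalgebra.centralizer ℂ
    (StarSubalgebra.centralizer ℂ (Set.range left) : Set (L2 →L[ℂ] L2)) := T.2
  refine ((StarSubalgebra.mem_centralizer_iff ℂ).1 hT (right a) ?_).1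
  rw [SetLike.mem_coe, StarSubalgebra.mem_centralizer_iff]
  rintro _ ⟨b, rfl⟩
  exact ⟨left_mul_right b a, by rw [star_left, left_mul_right]⟩

lemma left_mem (a : matUnion) : left a ∈ R.toStarSubalgebra := by
  change left a ∈ StarSubalgebra.centralizer ℂ
    (StarSubalgebra.centralizer ℂ (Set.range left) : Set (L2 →L[ℂ] L2))
  rw [StarSubalgebra.mem_centralizer_iff]
  intro g hg
  rw [SetLike.mem_coe, StarSubalgebra.mem_centralizer_iff] at hg
  have h := hg (left a) ⟨a, rfl⟩
  refine ⟨h.1.symm, ?_⟩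
  have h2 := congrArg star h.2
  simpa using h2

/-- The trace vector, the class of the identity matrix. -/
def vac : L2 := ((toL2 1 : PreL2) : L2)

/-- The tracial state of `R`, extending the normalized traces of the matrices. -/
def tr (T : RAlg) : ℂ := ⟪vac, T.1 vac⟫_ℂ

lemma tr_left (a : matUnion) : tr ⟨left a, left_mem a⟩ = matTrace a := by
  rw [tr, vac, left_coe, UniformSpace.Completion.inner_coe, preL2_inner, star_one, one_mul, mul_one]

lemma right_vac (a : matUnion) : right a vac = (toL2 a : L2) := by
  rw [vac, right_coe, one_mul]

lemma inner_toL2 (T : RAlg) (a : matUnion) :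
    ⟪((toL2 a : PreL2) : L2), T.1 vac⟫_ℂ = ⟪(star T).1 vac, ((toL2 (star a) : PreL2) : L2)⟫_ℂ := by
  rw [← right_vac a, ← ContinuousLinearMap.adjoint_inner_right, adjoint_right,
    ← mul_apply_eq_comp, right_comm, mul_apply_eq_comp, right_vac]
  change _ = ⟪T.1.adjoint vac, _⟫_ℂ
  rw [ContinuousLinearMap.adjoint_inner_left]

lemma isometry_star : Isometry fun x : PreL2 => toL2 (star (toL2.symm x)) := by
  refine Isometry.of_dist_eq fun x y => ?_
  rw [dist_eq_norm, dist_eq_norm, ← map_sub, ← star_sub, preL2_norm_star, ← map_sub]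
  rfl

/-- The conjugation `a ↦ a*` of `L²(tr)`. -/
def conjL2 : L2 → L2 := UniformSpace.Completion.map fun x : PreL2 => toL2 (star (toL2.symm x))

lemma continuous_conjL2 : Continuous conjL2 := UniformSpace.Completion.continuous_map

lemma conjL2_coe (a : matUnion) : conjL2 (toL2 a : L2) = (toL2 (star a) : L2) := by
  rw [conjL2, UniformSpace.Completion.map_coe isometry_star.uniformContinuous]; rfl

lemma inner_conjL2 (x : L2) (a : matUnion) :
    ⟪conjL2 x, ((toL2 (star a) : PreL2) : L2)⟫_ℂ = ⟪((toL2 a : PreL2) : L2), x⟫_ℂ := by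
  have := continuous_conjL2
  refine dense_coe (fun x => ⟪conjL2 x, ((toL2 (star a) : PreL2) : L2)⟫_ℂ =
    ⟪((toL2 a : PreL2) : L2), x⟫_ℂ) (isClosed_eq (by fun_prop) (by fun_prop)) (fun b => ?_) x
  rw [conjL2_coe, UniformSpace.Completion.inner_coe, UniformSpace.Completion.inner_coe,
    preL2_inner, preL2_inner, star_star, matTrace_mul_comm]

lemma conjL2_vac (T : RAlg) : conjL2 (T.1 vac) = (star T).1 vac := by
  refine ext_inner_right ℂ fun y => ?_
  refine dense_coe (fun y => ⟪conjL2 (T.1 vac), y⟫_ℂ = ⟪(star T).1 vac, y⟫_ℂ)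
    (isClosed_eq (by fun_prop) (by fun_prop)) (fun a => ?_) y
  have := inner_conjL2 (T.1 vac) (star a)
  rw [star_star] at this
  rw [this, inner_toL2, star_star]

lemma inner_conj_vac (T : RAlg) (x : L2) : ⟪conjL2 x, T.1 vac⟫_ℂ = ⟪(star T).1 vac, x⟫_ℂ := by
  have := continuous_conjL2
  refine dense_coe (fun x => ⟪conjL2 x, T.1 vac⟫_ℂ = ⟪(star T).1 vac, x⟫_ℂ)
    (isClosed_eq (by fun_prop) (by fun_prop)) (fun a => ?_) x
  rw [conjL2_coe, inner_toL2, star_star]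

lemma tr_mul (S T : RAlg) : tr (S * T) = ⟪(star S).1 vac, T.1 vac⟫_ℂ := by
  change ⟪vac, S.1 (T.1 vac)⟫_ℂ = ⟪S.1.adjoint vac, _⟫_ℂ
  rw [ContinuousLinearMap.adjoint_inner_left]

lemma tr_mul_comm (S T : RAlg) : tr (S * T) = tr (T * S) := by
  rw [tr_mul, tr_mul, ← inner_conj_vac, conjL2_vac]

lemma tr_mul_star (T : RAlg) : tr (T * star T) = ((‖T.1 vac‖ ^ 2 : ℝ) : ℂ) := by
  rw [tr_mul_comm, tr_mul, star_star, inner_self_eq_norm_sq_to_K]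
  simp

/-- The `*`-algebra `R^(I)` of the norm-bounded families in `R`. -/
def boundedFamilies (I : Type) : StarSubalgebra ℂ (I → RAlg) where
  carrier := {a | ∃ C : ℝ, ∀ i, ‖(a i).1‖ ≤ C}
  mul_mem' := by
    rintro a b ⟨C, hC⟩ ⟨D, hD⟩
    refine ⟨C * D, fun i => (norm_mul_le (a i).1 (b i).1).trans ?_⟩
    exact mul_le_mul (hC i) (hD i) (norm_nonneg _) ((norm_nonneg _).trans (hC i))
  add_mem' := by
    rintro a b ⟨C, hC⟩ ⟨D, hD⟩
    exact ⟨C + D, fun i => (norm_add_le (a i).1 (b i).1).trans (add_le_add (hC i) (hD i))⟩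
  algebraMap_mem' := fun c => ⟨‖algebraMap ℂ (L2 →L[ℂ] L2) c‖, fun i => le_rfl⟩
  star_mem' := by
    rintro a ⟨C, hC⟩
    exact ⟨C, fun i => (norm_star (a i).1).le.trans (hC i)⟩

/-- Convergence to `0` in the trace norm along the ultrafilter `ω`. -/
def IsNull {I : Type} (ω : Ultrafilter I) (a : I → RAlg) : Prop :=
  Filter.Tendsto (fun i => tr (a i * star (a i))) ω (𝓝 0)

lemma isNull_iff {I : Type} (ω : Ultrafilter I) (a : I → RAlg) :
    IsNull ω a ↔ Filter.Tendsto (fun i => ‖(a i).1 vac‖) ω (𝓝 0) := by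
  simp only [IsNull, tr_mul_star]
  rw [← Complex.ofReal_zero, show Filter.Tendsto (fun i => ((‖(a i).1 vac‖ ^ 2 : ℝ) : ℂ)) ω
    (𝓝 ((0 : ℝ) : ℂ)) ↔ Filter.Tendsto (fun i => ‖(a i).1 vac‖ ^ 2) ω (𝓝 0) from
      Filter.tendsto_ofReal_iff]
  constructor
  · intro h
    have := h.sqrt
    simpa [Real.sqrt_sq] using this
  · intro h
    simpa using h.pow 2

lemma IsNull.star {I : Type} {ω : Ultrafilter I} {a : I → RAlg} (h : IsNull ω a) :
    IsNull ω (star a) := by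
  refine h.congr fun i => ?_
  rw [Pi.star_apply, star_star, tr_mul_comm]

lemma IsNull.mul_left {I : Type} {ω : Ultrafilter I} {a : I → RAlg} (h : IsNull ω a)
    {b : I → RAlg} (hb : ∃ C : ℝ, ∀ i, ‖(b i).1‖ ≤ C) : IsNull ω (b * a) := by
  obtain ⟨C, hC⟩ := hb
  rw [isNull_iff] at h ⊢
  refine squeeze_zero (fun _ => norm_nonneg _) (fun i => ?_) (by simpa using h.const_mul C)
  exact ((b i).1.le_opNorm ((a i).1 vac)).trans
    (mul_le_mul_of_nonneg_right (hC i) (norm_nonneg _))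

lemma IsNull.add {I : Type} {ω : Ultrafilter I} {a b : I → RAlg} (ha : IsNull ω a)
    (hb : IsNull ω b) : IsNull ω (a + b) := by
  rw [isNull_iff] at ha hb ⊢
  refine squeeze_zero (fun _ => norm_nonneg _) (fun i => ?_) (by simpa using ha.add hb)
  exact norm_add_le ((a i).1 vac) ((b i).1 vac)

lemma isNull_zero {I : Type} (ω : Ultrafilter I) : IsNull ω (0 : I → RAlg) := by
  rw [isNull_iff]
  simp

/-- The ideal `J_ω` of the bounded families `a` with `lim_ω tr (a_i a_i*) = 0`. -/
def nullIdeal {I : Type} (ω : Ultrafilter I) : Ideal (boundedFamilies I) where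
  carrier := {a | IsNull ω a.1}
  zero_mem' := isNull_zero ω
  add_mem' := fun ha hb => IsNull.add ha hb
  smul_mem' := fun b _ ha => IsNull.mul_left ha b.2

lemma star_mem_nullIdeal {I : Type} {ω : Ultrafilter I} {a : boundedFamilies I}
    (h : a ∈ nullIdeal ω) : star a ∈ nullIdeal ω := IsNull.star h

instance {I : Type} (ω : Ultrafilter I) : (nullIdeal ω).IsTwoSided where
  mul_mem_of_left := by
    intro a b ha
    have h := star_mem_nullIdeal ((nullIdeal ω).mul_mem_left (star b) (star_mem_nullIdeal ha))
    rwa [star_mul, star_star, star_star] at h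

/-- The ultrapower `R^ω = R^(I) / J_ω`. -/
abbrev UltraR {I : Type} (ω : Ultrafilter I) : Type := boundedFamilies I ⧸ nullIdeal ω

/-- The involution of `R^ω` is induced by the one of `R^(I)`. -/
instance {I : Type} (ω : Ultrafilter I) : StarRing (UltraR ω) where
  star := Quotient.map' star (by
    intro a b h
    rw [Submodule.quotientRel_def] at h ⊢
    have h2 := star_mem_nullIdeal h
    rwa [star_sub] at h2)
  star_involutive := by
    rintro ⟨a⟩
    exact congrArg (Ideal.Quotient.mk (nullIdeal ω)) (star_star a)
  star_mul := by
    rintro ⟨a⟩ ⟨b⟩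
    exact congrArg (Ideal.Quotient.mk (nullIdeal ω)) (star_mul a b)
  star_add := by
    rintro ⟨a⟩ ⟨b⟩
    exact congrArg (Ideal.Quotient.mk (nullIdeal ω)) (star_add a b)

end HyperfiniteFactor

/-- A (countable) group is hyperlinear if it embeds in the unitary group of `R^ω`, where `ω` is a
nonprincipal ultrafilter on a countable set. As `ω` is arbitrary there, the embedding is asked for
every such `ω`, not only for a suitable one. -/
def IsHyperlinear (G : Type) [Group G] : Prop :=
  ∀ (I : Type) [Countable I] (ω : Ultrafilter I), (∀ i, ω ≠ pure i) →
    ∃ f : G →* unitary (HyperfiniteFactor.UltraR ω), Function.Injective f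

/-- A group is amenable if it has a left-invariant finitely additive probability measure,
defined on all of its subsets. -/
def IsAmenableGroup (G : Type) [Group G] : Prop :=
  ∃ μ : Set G → ℝ, (∀ A, 0 ≤ μ A) ∧ μ Set.univ = 1 ∧
    (∀ A B, Disjoint A B → μ (A ∪ B) = μ A + μ B) ∧
    ∀ (g : G) (A : Set G), μ ((fun x => g * x) '' A) = μ A

/-- A group is residually amenable if every nontrivial element survives in an amenable quotient. -/
def IsResiduallyAmenable (G : Type) [Group G] : Prop :=
  ∀ g : G, g ≠ 1 → ∃ (N : Subgroup G) (_ : N.Normal), g ∉ N ∧ IsAmenableGroup (G ⧸ N)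

end

open scoped InnerProductSpace Topology

noncomputable section

/-! Both examples are hyperlinear because they are locally embeddable into finite groups
(`IsLEF.isHyperlinear`). A finite group acts on itself by permutation matrices, which lie in `R`,
and every nontrivial element gets trace `0`. Choosing better and better finite models along the
index set gives a homomorphism to the unitaries of `R^ω`. It is injective because a unitary of trace
`0` stays at distance `√2` from `1` in the trace norm.

The simple group is `PSL(2, ℚ)`. Finitely many rational matrices reduce modulo a large prime, so it
is locally embeddable into finite groups (`isLEF_PSL2Q`). A paradoxical set defined by the signs of
the first column shows that it is not amenable (`not_isAmenableGroup_PSL`).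

The finitely generated group consists of lamps from `S₃` moved by `SL(2, ℤ)`, and is realised in a
reduced product of finite permutation groups (`isLEF_reducedProduct`). Lamps at different places
commute, so a normal subgroup meeting `SL(2, ℤ)` nontrivially contains a fixed nontrivial commutator
of lamps. A quotient in which this commutator survives therefore contains the non-amenable group
`SL(2, ℤ)` (`not_isResiduallyAmenable_lampGroup`). -/

/-- A group is locally embeddable into finite groups if for each finite subset `F` there is a map
to a finite group which is multiplicative on `F` and sends no nontrivial element of `F` to `1`. -/
def IsLEF (G : Type) [Group G] : Prop :=
  ∀ F : Finset G, ∃ (Q : Type) (_ : Group Q) (_ : Finite Q) (φ : G → Q),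
    (∀ g ∈ F, ∀ h ∈ F, φ (g * h) = φ g * φ h) ∧ ∀ g ∈ F, g ≠ 1 → φ g ≠ 1

/-! ### Finite groups in the unitary group of `R`, and unitaries of `R^ω`. -/

namespace HyperfiniteFactor

lemma left_mul (a b : matUnion) : left (a * b) = left a * left b := by
  ext x
  refine dense_coe (fun x => left (a * b) x = (left a * left b) x)
    (isClosed_eq (by fun_prop) (by fun_prop)) (fun c => ?_) x
  simp only [mul_apply_eq_comp, left_coe, mul_assoc]

lemma left_one : left 1 = 1 := by
  ext x
  refine dense_coe (fun x => left 1 x = (1 : L2 →L[ℂ] L2) x)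
    (isClosed_eq (by fun_prop) (by fun_prop)) (fun c => ?_) x
  rw [left_coe, one_mul]
  rfl

/-- The embedding of the `k × k` matrices in the hyperfinite factor. -/
def matHom {k : ℕ} (hk : 0 < k) : Matrix (Fin k) (Fin k) ℂ →* RAlg where
  toFun A := ⟨left ⟨rho k A, rho_mem hk A⟩, left_mem _⟩
  map_one' := by
    apply Subtype.ext
    change left ⟨rho k 1, _⟩ = 1
    rw [← left_one]
    congr 1
    exact Subtype.ext (rho_one hk)
  map_mul' A B := by
    apply Subtype.ext
    change left ⟨rho k (A * B), _⟩ = left _ * left _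
    rw [← left_mul]
    congr 1
    exact Subtype.ext (rho_mul hk A B)

lemma matHom_star {k : ℕ} (hk : 0 < k) (A : Matrix (Fin k) (Fin k) ℂ) :
    star (matHom hk A) = matHom hk A.conjTranspose := by
  apply Subtype.ext
  change star (left _) = left _
  rw [star_left]
  congr 1
  exact Subtype.ext (rho_star k A).symm

lemma tr_matHom {k : ℕ} (hk : 0 < k) (A : Matrix (Fin k) (Fin k) ℂ) :
    tr (matHom hk A) = A.trace / k :=
  (tr_left _).trans (matTrace_eq hk A _ rfl)

/-- The regular representation of a finite group, as unitaries of the hyperfinite factor. -/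
lemma exists_regular (Q : Type) [Group Q] [Finite Q] :
    ∃ u : Q →* unitary RAlg, ∀ q, q ≠ 1 → tr (u q : RAlg) = 0 := by
  classical
  have hk : 0 < Nat.card Q := Nat.card_pos
  let σ : Q →* Equiv.Perm (Fin (Nat.card Q)) :=
    (Finite.equivFin Q).permCongrHom.toMonoidHom.comp (MulAction.toPermHom Q Q)
  have hσ : ∀ q x, σ q x = Finite.equivFin Q (q * (Finite.equivFin Q).symm x) := fun q x => rfl
  have hP : ∀ s : Equiv.Perm (Fin (Nat.card Q)),
      Matrix.permMatrixHom (R := ℂ) s = s⁻¹.permMatrix ℂ := fun _ => rfl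
  let v : Q →* RAlg := (matHom hk).comp ((Matrix.permMatrixHom (R := ℂ)).comp σ)
  have hv : ∀ q, star (v q) = v q⁻¹ := by
    intro q
    change star (matHom hk (Matrix.permMatrixHom (R := ℂ) (σ q))) =
      matHom hk (Matrix.permMatrixHom (R := ℂ) (σ q⁻¹))
    rw [matHom_star, hP, hP, Matrix.conjTranspose_permMatrix, map_inv]
  refine ⟨v.codRestrict (unitary RAlg) fun q => ?_, fun q hq => ?_⟩
  · rw [Unitary.mem_iff, hv, ← map_mul, ← map_mul, inv_mul_cancel, mul_inv_cancel, map_one]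
    exact ⟨rfl, rfl⟩
  · change tr (matHom hk (Matrix.permMatrixHom (R := ℂ) (σ q))) = 0
    rw [tr_matHom, div_eq_zero_iff]
    left
    rw [Matrix.trace]
    refine Finset.sum_eq_zero fun x _ => ?_
    have hne : ∀ p : Q, p ≠ 1 → σ p x ≠ x := by
      intro p hp h
      rw [hσ, ← Equiv.eq_symm_apply, mul_eq_right] at h
      exact hp h
    -- `permMatrixHom` sends a permutation to the matrix of its inverse, so the diagonal records the
    -- fixed points of `σ q⁻¹`; left translation is free, so there are none.
    have h2 := hne q⁻¹ (by simpa using hq)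
    rw [map_inv] at h2
    rw [hP]
    simpa [Equiv.Perm.permMatrix, PEquiv.toMatrix_apply, Matrix.diag] using h2

lemma norm_unitary_le (u : unitary RAlg) : ‖(u : RAlg).1‖ ≤ 1 := by
  have h : star (u : RAlg).1 * (u : RAlg).1 = 1 := congrArg Subtype.val (Unitary.coe_star_mul_self u)
  have h2 := CStarRing.norm_star_mul_self (x := (u : RAlg).1)
  rw [h] at h2
  have h3 : ‖(1 : L2 →L[ℂ] L2)‖ ≤ 1 := ContinuousLinearMap.norm_id_le
  nlinarith [norm_nonneg (u : RAlg).1]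

lemma tr_add (S T : RAlg) : tr (S + T) = tr S + tr T := by
  change ⟪vac, (S.1 + T.1) vac⟫_ℂ = _
  rw [add_apply, inner_add_right]; rfl

lemma tr_sub (S T : RAlg) : tr (S - T) = tr S - tr T := by
  change ⟪vac, (S.1 - T.1) vac⟫_ℂ = _
  rw [sub_apply, inner_sub_right]; rfl

lemma tr_one : tr 1 = 1 := by
  have := tr_matHom one_pos 1
  simpa using this

/-- A family of unitaries of `R`, as an element of `R^(I)`. -/
def unitaryFamily {I : Type} (u : I → unitary RAlg) : boundedFamilies I :=
  ⟨fun i => (u i : RAlg), 1, fun i => norm_unitary_le (u i)⟩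

lemma mk_eq_of_eventually {I : Type} {ω : Ultrafilter I} {a b : boundedFamilies I}
    (h : ∀ᶠ i in (ω : Filter I), a.1 i = b.1 i) :
    Ideal.Quotient.mk (nullIdeal ω) a = Ideal.Quotient.mk (nullIdeal ω) b := by
  rw [Ideal.Quotient.eq]
  change IsNull ω (a.1 - b.1)
  rw [isNull_iff]
  refine tendsto_const_nhds.congr' ?_
  filter_upwards [h] with i hi
  simp [hi]

/-- The class in `R^ω` of a family of unitaries of `R`. -/
def unitaryClass {I : Type} (ω : Ultrafilter I) (u : I → unitary RAlg) : unitary (UltraR ω) :=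
  ⟨Ideal.Quotient.mk (nullIdeal ω) (unitaryFamily u), by
    have h1 : star (unitaryFamily u) * unitaryFamily u = 1 :=
      Subtype.ext (funext fun i => Unitary.coe_star_mul_self (u i))
    have h2 : unitaryFamily u * star (unitaryFamily u) = 1 :=
      Subtype.ext (funext fun i => Unitary.coe_mul_star_self (u i))
    exact Unitary.mem_iff.2 ⟨congrArg (Ideal.Quotient.mk (nullIdeal ω)) h1,
      congrArg (Ideal.Quotient.mk (nullIdeal ω)) h2⟩⟩

lemma unitaryClass_eq_of_eventually {I : Type} {ω : Ultrafilter I} {u v : I → unitary RAlg}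
    (h : ∀ᶠ i in (ω : Filter I), u i = v i) : unitaryClass ω u = unitaryClass ω v :=
  Subtype.ext (mk_eq_of_eventually (h.mono fun _ hi => congrArg Subtype.val hi))

lemma unitaryClass_mul {I : Type} (ω : Ultrafilter I) (u v : I → unitary RAlg) :
    unitaryClass ω (fun i => u i * v i) = unitaryClass ω u * unitaryClass ω v := rfl

lemma tr_sub_one_mul_star (u : unitary RAlg) (h : tr (u : RAlg) = 0)
    (h' : tr (star (u : RAlg)) = 0) :
    tr (((u : RAlg) - 1) * star ((u : RAlg) - 1)) = 2 := by
  have : ((u : RAlg) - 1) * star ((u : RAlg) - 1) = 1 - (u : RAlg) - star (u : RAlg) + 1 := by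
    have hu : (u : RAlg) * star (u : RAlg) = 1 := Unitary.coe_mul_star_self u
    rw [star_sub, star_one, sub_mul, mul_sub, mul_sub, hu]
    simp only [mul_one, one_mul]
    abel
  rw [this, tr_add, tr_sub, tr_sub, h, h', tr_one]
  norm_num

/-- The squared trace-norm distance to `1` equals `2` for almost every index, so it cannot tend to
`0`. -/
lemma unitaryClass_ne_one {I : Type} {ω : Ultrafilter I} {u : I → unitary RAlg}
    (h : ∀ᶠ i in (ω : Filter I), tr (u i : RAlg) = 0 ∧ tr (star (u i : RAlg)) = 0) :
    unitaryClass ω u ≠ 1 := by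
  intro hu
  have h1 : Ideal.Quotient.mk (nullIdeal ω) (unitaryFamily u) =
    Ideal.Quotient.mk (nullIdeal ω) 1 := congrArg Subtype.val hu
  rw [Ideal.Quotient.eq] at h1
  have h2 : Filter.Tendsto (fun i => tr (((u i : RAlg) - 1) * star ((u i : RAlg) - 1))) ω (𝓝 0) :=
    h1
  have h3 : Filter.Tendsto (fun i => tr (((u i : RAlg) - 1) * star ((u i : RAlg) - 1))) ω (𝓝 2) :=
    tendsto_const_nhds.congr' (h.mono fun i hi => (tr_sub_one_mul_star (u i) hi.1 hi.2).symm)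
  exact two_ne_zero (tendsto_nhds_unique h3 h2)

end HyperfiniteFactor

-- Finite sets exhausting `G` are indexed by `ℕ`, and an injection `num : I → ℕ` carries them to
-- `I`. As `ω` is nonprincipal, `num` tends to infinity along it, so each element of `G` lies in
-- almost every finite set used. This works for every such `ω`.
open HyperfiniteFactor in
theorem IsLEF.isHyperlinear {G : Type} [Group G] [Countable G] (hG : IsLEF G) :
    IsHyperlinear G := by
  intro I _ ω hω
  obtain ⟨enc, henc⟩ := exists_injective_nat G
  obtain ⟨num, hnum⟩ := exists_injective_nat I
  have hlim : Filter.Tendsto num ω Filter.atTop := by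
    rw [← Nat.cofinite_eq_atTop]
    refine hnum.tendsto_cofinite.mono_left ?_
    rcases ω.le_cofinite_or_eq_pure with h | ⟨i, h⟩
    · exact h
    · exact absurd h (hω i)
  have hfin : ∀ n, {g : G | enc g ≤ n}.Finite := fun n =>
    (Set.finite_Iic n).preimage henc.injOn
  choose Q _ _ φ hmul hne using fun n => hG (hfin n).toFinset
  choose u hu using fun n => exists_regular (Q n)
  have hev : ∀ g, ∀ᶠ i in (ω : Filter I), g ∈ (hfin (num i)).toFinset := fun g =>
    (hlim.eventually_ge_atTop (enc g)).mono fun i hi => by simpa using hi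
  refine ⟨MonoidHom.mk' (fun g => unitaryClass ω fun i => u (num i) (φ (num i) g)) ?_, ?_⟩
  · intro g h
    rw [← unitaryClass_mul]
    refine unitaryClass_eq_of_eventually ?_
    filter_upwards [hev g, hev h] with i hg hh
    rw [hmul _ g hg h hh, map_mul]
  · rw [injective_iff_map_eq_one]
    intro g hg
    by_contra hg1
    refine unitaryClass_ne_one ?_ hg
    filter_upwards [hev g] with i hi
    have h1 := hne _ g hi hg1
    refine ⟨hu _ _ h1, ?_⟩
    have h2 := hu _ (φ (num i) g)⁻¹ (inv_ne_one.2 h1)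
    rwa [map_inv] at h2

/-! ### Amenability: permanence properties and paradoxical sets. -/

/-- Amenability passes to subgroups and to quotients: an invariant measure is pushed forward by a
map which is equivariant along a section or an embedding. -/
lemma IsAmenableGroup.of_equivariant {G H : Type} [Group G] [Group H] (hG : IsAmenableGroup G)
    (c : G → H) (s : H → G) (hc : ∀ h g, c (s h * g) = h * c g) : IsAmenableGroup H := by
  obtain ⟨μ, h0, h1, hadd, hinv⟩ := hG
  refine ⟨fun A => μ (c ⁻¹' A), fun A => h0 _, h1, fun A B h => ?_, fun h A => ?_⟩
  · exact hadd _ _ (h.preimage c)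
  · change μ _ = μ _
    rw [← hinv (s h) (c ⁻¹' A)]
    congr 1
    ext g
    simp only [Set.mem_preimage, Set.mem_image]
    constructor
    · rintro ⟨x, hx, hxg⟩
      refine ⟨(s h)⁻¹ * g, ?_, by group⟩
      have := hc h ((s h)⁻¹ * g)
      rw [mul_inv_cancel_left, ← hxg, mul_right_inj] at this
      rwa [← this]
    · rintro ⟨x, hx, rfl⟩
      exact ⟨c x, hx, (hc h x).symm⟩

lemma IsAmenableGroup.of_surjective {G H : Type} [Group G] [Group H] (hG : IsAmenableGroup G)
    (f : G →* H) (hf : Function.Surjective f) : IsAmenableGroup H :=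
  hG.of_equivariant f (Function.surjInv hf) fun h g => by
    rw [map_mul, Function.surjInv_eq hf]

/-- With a representative `r g` of each right coset of the image of `H`, the factor `g * (r g)⁻¹`
lies in that image. Left multiplication by `f h` keeps the coset, so the resulting map `c : G → H`
is equivariant. -/
lemma IsAmenableGroup.of_injective {G H : Type} [Group G] [Group H] (hG : IsAmenableGroup G)
    (f : H →* G) (hf : Function.Injective f) : IsAmenableGroup H := by
  let r : G → G := fun g => Quotient.out (Quotient.mk (QuotientGroup.rightRel f.range) g)
  have hr : ∀ g, ∃ h, f h = g * (r g)⁻¹ := fun g => by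
    have : QuotientGroup.rightRel f.range (r g) g := Quotient.exact (Quotient.out_eq _)
    exact QuotientGroup.rightRel_apply.1 this
  choose c hc using hr
  refine hG.of_equivariant c f fun h g => hf ?_
  have : r (f h * g) = r g := by
    refine congrArg Quotient.out (Quotient.sound ?_)
    refine QuotientGroup.rightRel_apply.2 ⟨h⁻¹, ?_⟩
    rw [map_inv]; group
  rw [hc, map_mul, hc, this, mul_assoc]

/-- A group is not amenable if a syndetic set contains two disjoint translates of itself. -/
lemma not_isAmenableGroup_of_paradox {G : Type} [Group G] (P : Set G) (s t u : G)
    (ht : ∀ g ∈ P, t * g ∈ P) (hu : ∀ g ∈ P, u * g ∈ P) (htu : ∀ g ∈ P, ∀ h ∈ P, t * g ≠ u * h)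
    (hcov : ∀ g, g ∈ P ∨ s * g ∈ P ∨ t * g ∈ P ∨ u * g ∈ P) : ¬ IsAmenableGroup G := by
  rintro ⟨μ, h0, h1, hadd, hinv⟩
  have hmono : ∀ A B, A ⊆ B → μ A ≤ μ B := fun A B h => by
    rw [← Set.union_sdiff_cancel h, hadd _ _ Set.disjoint_sdiff_right]
    linarith [h0 (B \ A)]
  have hsub : ∀ A B, μ (A ∪ B) ≤ μ A + μ B := fun A B => by
    rw [← Set.union_sdiff_self, hadd _ _ Set.disjoint_sdiff_right]
    linarith [hmono (B \ A) B Set.sdiff_subset]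
  -- Two disjoint translates inside `P` give `2 * μ P ≤ μ P`.
  have hP : μ P = 0 := by
    have hle := hmono ((fun x => t * x) '' P ∪ (fun x => u * x) '' P) P (by
      rintro _ (⟨g, hg, rfl⟩ | ⟨g, hg, rfl⟩)
      exacts [ht g hg, hu g hg])
    rw [hadd _ _ (Set.disjoint_left.2 ?_), hinv, hinv] at hle
    · linarith [h0 P]
    · rintro _ ⟨g, hg, rfl⟩ ⟨h, hh, hgh⟩
      exact htu g hg h hh hgh.symm
  have hpre : ∀ v : G, μ {g | v * g ∈ P} = 0 := fun v => by
    rw [← hP, ← hinv v⁻¹ P]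
    congr 1
    ext g
    refine ⟨fun hg => ⟨v * g, hg, inv_mul_cancel_left v g⟩, ?_⟩
    rintro ⟨x, hx, rfl⟩
    simpa using hx
  -- Four translates of the null set `P` cover the group, which has measure `1`.
  have hle := hmono Set.univ (P ∪ ({g | s * g ∈ P} ∪ ({g | t * g ∈ P} ∪ {g | u * g ∈ P})))
    fun g _ => hcov g
  have h3 := hsub P ({g | s * g ∈ P} ∪ ({g | t * g ∈ P} ∪ {g | u * g ∈ P}))
  have h4 := hsub {g | s * g ∈ P} ({g | t * g ∈ P} ∪ {g | u * g ∈ P})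
  have h5 := hsub {g | t * g ∈ P} {g | u * g ∈ P}
  rw [hpre, hpre] at h5
  rw [hpre] at h4
  linarith

/-! ### Non-amenability of `PSL(2, K)` over an ordered ring. -/

section

open scoped MatrixGroups

variable {K : Type} [CommRing K]

/-- The centre of `SL(2, K)` consists of the scalar matrices `r` with `r ^ 2 = 1`. -/
lemma PSL_mk_eq_iff (A B : SL(2, K)) :
    (QuotientGroup.mk A : PSL(2, K)) = QuotientGroup.mk B ↔
      ∃ r : K, r ^ 2 = 1 ∧ ∀ i j, B i j = A i j * r := by
  rw [QuotientGroup.eq, Matrix.SpecialLinearGroup.mem_center_iff]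
  refine exists_congr fun r => and_congr (by simp) ?_
  have h : A.1 * (A⁻¹ * B : SL(2, K)).1 = B.1 := by
    rw [← Matrix.SpecialLinearGroup.coe_mul, mul_inv_cancel_left]
  have h' : (A⁻¹ : SL(2, K)).1 * A.1 = 1 := by
    rw [← Matrix.SpecialLinearGroup.coe_mul, inv_mul_cancel]; rfl
  constructor
  · intro hr i j
    rw [← h, ← hr]
    simp
  · intro hr
    have hB : B.1 = A.1 * Matrix.scalar (Fin 2) r := by
      ext i j
      simpa using hr i j
    rw [Matrix.SpecialLinearGroup.coe_mul, hB, ← mul_assoc, h', one_mul]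

/-- For the first column `(x, y)` of a representing matrix, the numbers `x * y` and
`x ^ 2 - y ^ 2`. -/
def colForms : PSL(2, K) → K × K :=
  Quotient.lift (fun A : SL(2, K) => (A 0 0 * A 1 0, A 0 0 ^ 2 - A 1 0 ^ 2)) fun A B h => by
    obtain ⟨r, hr, hB⟩ := (PSL_mk_eq_iff A B).1 (Quotient.sound h)
    refine Prod.ext ?_ ?_
    · simp only [hB]; linear_combination (-A 0 0 * A 1 0) * hr
    · simp only [hB]; linear_combination (-A 0 0 ^ 2 + A 1 0 ^ 2) * hr

lemma colForms_mk (A : SL(2, K)) : colForms (QuotientGroup.mk A : PSL(2, K)) =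
    (A 0 0 * A 1 0, A 0 0 ^ 2 - A 1 0 ^ 2) := rfl

/-- On the first column, `t`, `u` and `s` map `(x, y)` to `(x + y, y)`, `(x, x + y)` and `(-y, x)`.
Take `P` to be `x * y > 0`, which does not depend on the sign of the matrix. Both `t` and `u`
preserve `P`, and the sign of `x ^ 2 - y ^ 2` is positive on `t P` and negative on `u P`. Outside
`P`, the element `s` handles `x * y < 0`, `t` handles `x = 0` and `u` handles `y = 0`. -/
lemma not_isAmenableGroup_PSL [LinearOrder K] [IsStrictOrderedRing K] :
    ¬ IsAmenableGroup PSL(2, K) := by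
  let s : SL(2, K) := ⟨!![0, -1; 1, 0], by simp⟩
  let t : SL(2, K) := ⟨!![1, 1; 0, 1], by simp⟩
  let u : SL(2, K) := ⟨!![1, 0; 1, 1], by simp⟩
  have hs : ∀ A : SL(2, K), (s * A) 0 0 = -A 1 0 ∧ (s * A) 1 0 = A 0 0 := fun A => by
    constructor <;> change (s.1 * A.1) _ _ = _ <;> simp [s, Matrix.mul_apply, Fin.sum_univ_two]
  have ht : ∀ A : SL(2, K), (t * A) 0 0 = A 0 0 + A 1 0 ∧ (t * A) 1 0 = A 1 0 := fun A => by
    constructor <;> change (t.1 * A.1) _ _ = _ <;> simp [t, Matrix.mul_apply, Fin.sum_univ_two]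
  have hu : ∀ A : SL(2, K), (u * A) 0 0 = A 0 0 ∧ (u * A) 1 0 = A 0 0 + A 1 0 := fun A => by
    constructor <;> change (u.1 * A.1) _ _ = _ <;> simp [u, Matrix.mul_apply, Fin.sum_univ_two]
  refine not_isAmenableGroup_of_paradox {g : PSL(2, K) | 0 < (colForms g).1}
    (QuotientGroup.mk s) (QuotientGroup.mk t) (QuotientGroup.mk u) ?_ ?_ ?_ ?_
  · intro g
    obtain ⟨A, rfl⟩ := QuotientGroup.mk_surjective g
    rw [← QuotientGroup.mk_mul]
    simp only [Set.mem_ofPred_eq, colForms_mk, ht]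
    intro h
    nlinarith [sq_nonneg (A 1 0)]
  · intro g
    obtain ⟨A, rfl⟩ := QuotientGroup.mk_surjective g
    rw [← QuotientGroup.mk_mul]
    simp only [Set.mem_ofPred_eq, colForms_mk, hu]
    intro h
    nlinarith [sq_nonneg (A 0 0)]
  · intro g
    obtain ⟨A, rfl⟩ := QuotientGroup.mk_surjective g
    intro hg h
    obtain ⟨B, rfl⟩ := QuotientGroup.mk_surjective h
    intro hh heq
    rw [← QuotientGroup.mk_mul, ← QuotientGroup.mk_mul] at heq
    have h1 := congrArg (fun g => (colForms g).2) heq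
    simp only [Set.mem_ofPred_eq, colForms_mk, hu, ht] at hg hh h1
    nlinarith [sq_nonneg (A 0 0), sq_nonneg (B 1 0)]
  · intro g
    obtain ⟨A, rfl⟩ := QuotientGroup.mk_surjective g
    rw [← QuotientGroup.mk_mul, ← QuotientGroup.mk_mul, ← QuotientGroup.mk_mul]
    simp only [Set.mem_ofPred_eq, colForms_mk, hu, ht, hs]
    have hdet : A 0 0 * A 1 1 - A 0 1 * A 1 0 = 1 := by
      rw [← Matrix.det_fin_two]; exact A.2
    rcases lt_trichotomy (A 0 0 * A 1 0) 0 with h | h | h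
    · exact Or.inr (Or.inl (by linarith))
    · rcases mul_eq_zero.1 h with h0 | h0
      · have h1 : A 1 0 ≠ 0 := fun h1 => by simp [h0, h1] at hdet
        refine Or.inr (Or.inr (Or.inl ?_))
        rw [h0, zero_add]
        exact mul_self_pos.2 h1
      · have h1 : A 0 0 ≠ 0 := fun h1 => by simp [h0, h1] at hdet
        refine Or.inr (Or.inr (Or.inr ?_))
        rw [h0, add_zero]
        exact mul_self_pos.2 h1
    · exact Or.inl h

lemma not_isAmenableGroup_SL2Z : ¬ IsAmenableGroup SL(2, ℤ) := fun h =>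
  not_isAmenableGroup_PSL (K := ℤ) (h.of_surjective _ (QuotientGroup.mk'_surjective _))

end

lemma IsLEF.of_injective {G H : Type} [Group G] [Group H] (hG : IsLEF G) (f : H →* G)
    (hf : Function.Injective f) : IsLEF H := by
  classical
  intro F
  obtain ⟨Q, _, _, φ, hmul, hne⟩ := hG (F.image f)
  refine ⟨Q, inferInstance, inferInstance, φ ∘ f, fun g hg h hh => ?_, fun g hg hg1 => ?_⟩
  · rw [Function.comp_apply, map_mul]
    exact hmul _ (Finset.mem_image_of_mem f hg) _ (Finset.mem_image_of_mem f hh)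
  · exact hne _ (Finset.mem_image_of_mem f hg) ((map_ne_one_iff f hf).2 hg1)

/-! ### Reduction modulo large primes, and local finiteness of `PSL(2, ℚ)`. -/

section Reduction

open scoped MatrixGroups

lemma eventually_intCast_ne_zero {x : ℤ} (hx : x ≠ 0) :
    ∀ᶠ n : ℕ in Filter.atTop, (x : ZMod n) ≠ 0 := by
  filter_upwards [Filter.eventually_gt_atTop x.natAbs] with n hn h
  rw [ZMod.intCast_zmod_eq_zero_iff_dvd] at h
  exact hx (Int.eq_zero_of_abs_lt_dvd h (by rw [Int.abs_eq_natAbs]; exact_mod_cast hn))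

lemma eventually_den_ne_zero (x : ℚ) : ∀ᶠ p : ℕ in Filter.atTop, (x.den : ZMod p) ≠ 0 := by
  simpa using eventually_intCast_ne_zero (x := x.den) (by exact_mod_cast x.den_ne_zero)

lemma eventually_ratCast_ne_zero {x : ℚ} (hx : x ≠ 0) :
    ∀ᶠ p : ℕ in Filter.atTop, ∀ [Fact p.Prime], (x : ZMod p) ≠ 0 := by
  filter_upwards [eventually_den_ne_zero x, eventually_intCast_ne_zero (Rat.num_ne_zero.2 hx)]
    with p h1 h2 _
  rw [Rat.cast_def]
  exact div_ne_zero h2 h1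

variable {p : ℕ} [Fact p.Prime]

lemma den_mul_ne_zero {x y : ℚ} (hx : (x.den : ZMod p) ≠ 0) (hy : (y.den : ZMod p) ≠ 0) :
    ((x * y).den : ZMod p) ≠ 0 := by
  intro h
  have := (ZMod.natCast_eq_zero_iff _ _).1 h
  have := (ZMod.natCast_eq_zero_iff _ _).2 (this.trans (Rat.mul_den_dvd x y))
  rw [Nat.cast_mul] at this
  exact mul_ne_zero hx hy this

/-- The cast `ℚ → ZMod p` respects sums and products only when `p` divides no denominator involved.
This is the shape of an entry of a product of `2 × 2` matrices, and of the determinant. -/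
lemma cast_mul_add_mul {a b c d : ℚ} (ha : (a.den : ZMod p) ≠ 0) (hb : (b.den : ZMod p) ≠ 0)
    (hc : (c.den : ZMod p) ≠ 0) (hd : (d.den : ZMod p) ≠ 0) :
    ((a * b + c * d : ℚ) : ZMod p) = a * b + c * d := by
  rw [Rat.cast_add_of_ne_zero (den_mul_ne_zero ha hb) (den_mul_ne_zero hc hd),
    Rat.cast_mul_of_ne_zero ha hb, Rat.cast_mul_of_ne_zero hc hd]

/-- Reduction modulo `p` of a rational matrix with denominators prime to `p`. -/
def reduceMod (p : ℕ) [Fact p.Prime] (A : SL(2, ℚ))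
    (hA : ∀ i j, ((A i j).den : ZMod p) ≠ 0) : SL(2, ZMod p) :=
  ⟨A.1.map (fun x : ℚ => (x : ZMod p)), by
    have hdet : A 0 0 * A 1 1 + -A 0 1 * A 1 0 = 1 := by
      have := A.2
      rw [Matrix.det_fin_two] at this
      linear_combination this
    have h := cast_mul_add_mul (p := p) (hA 0 0) (hA 1 1)
      (show ((-A 0 1).den : ZMod p) ≠ 0 by simpa using hA 0 1) (hA 1 0)
    rw [hdet, Rat.cast_one, Rat.cast_neg] at h
    rw [Matrix.det_fin_two]
    simp only [Matrix.map_apply]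
    linear_combination -h⟩

lemma reduceMod_apply (A : SL(2, ℚ)) (hA : ∀ i j, ((A i j).den : ZMod p) ≠ 0) (i j : Fin 2) :
    reduceMod p A hA i j = ((A i j : ℚ) : ZMod p) := rfl

lemma mk_reduceMod_mul {A B C : SL(2, ℚ)} (hA : ∀ i j, ((A i j).den : ZMod p) ≠ 0)
    (hB : ∀ i j, ((B i j).den : ZMod p) ≠ 0) (hC : ∀ i j, ((C i j).den : ZMod p) ≠ 0)
    (h : (QuotientGroup.mk C : PSL(2, ℚ)) = QuotientGroup.mk A * QuotientGroup.mk B) :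
    (QuotientGroup.mk (reduceMod p C hC) : PSL(2, ZMod p)) =
      QuotientGroup.mk (reduceMod p A hA) * QuotientGroup.mk (reduceMod p B hB) := by
  rw [← QuotientGroup.mk_mul] at h ⊢
  obtain ⟨r, hr, hCr⟩ := (PSL_mk_eq_iff _ _).1 h.symm
  rw [eq_comm, PSL_mk_eq_iff]
  refine ⟨r, ?_, fun i j => ?_⟩
  · rcases eq_or_eq_neg_of_sq_eq_sq r 1 (by rw [hr, one_pow]) with rfl | rfl <;> simp
  · have h1 : (A * B) i j = A i 0 * B 0 j + A i 1 * B 1 j := by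
      change (A.1 * B.1) i j = _
      rw [Matrix.mul_apply, Fin.sum_univ_two]
    have h2 : (reduceMod p A hA * reduceMod p B hB) i j =
        reduceMod p A hA i 0 * reduceMod p B hB 0 j +
          reduceMod p A hA i 1 * reduceMod p B hB 1 j := by
      change ((reduceMod p A hA).1 * (reduceMod p B hB).1) i j = _
      rw [Matrix.mul_apply, Fin.sum_univ_two]
    rw [h2, reduceMod_apply, hCr, h1]
    simp only [reduceMod_apply]
    rw [← cast_mul_add_mul (hA _ _) (hB _ _) (hA _ _) (hB _ _)]
    -- The representatives `C` and `A * B` differ by a sign, which survives reduction.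
    rcases eq_or_eq_neg_of_sq_eq_sq r 1 (by rw [hr, one_pow]) with rfl | rfl
    · simp
    · rw [mul_neg_one, Rat.cast_neg]
      simp

/-- A matrix is trivial in `PSL` exactly when it is scalar, that is, when three numbers vanish: the
off-diagonal entries and the difference of the diagonal ones. It suffices that `p` keeps the nonzero
ones among them nonzero. -/
lemma mk_reduceMod_ne_one {A : SL(2, ℚ)} (hA : ∀ i j, ((A i j).den : ZMod p) ≠ 0)
    (h1 : A 0 1 ≠ 0 → ((A 0 1 : ℚ) : ZMod p) ≠ 0) (h2 : A 1 0 ≠ 0 → ((A 1 0 : ℚ) : ZMod p) ≠ 0)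
    (h3 : A 0 0 - A 1 1 ≠ 0 → ((A 0 0 - A 1 1 : ℚ) : ZMod p) ≠ 0)
    (h : (QuotientGroup.mk A : PSL(2, ℚ)) ≠ 1) :
    (QuotientGroup.mk (reduceMod p A hA) : PSL(2, ZMod p)) ≠ 1 := by
  contrapose! h
  rw [← QuotientGroup.mk_one, eq_comm, PSL_mk_eq_iff] at h ⊢
  obtain ⟨r, hr, hAr⟩ := h
  simp only [reduceMod_apply] at hAr
  have e1 : A 0 1 = 0 := by
    by_contra h
    exact h1 h (by simp [hAr])
  have e2 : A 1 0 = 0 := by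
    by_contra h
    exact h2 h (by simp [hAr])
  have e3 : A 0 0 = A 1 1 := by
    by_contra h
    refine h3 (sub_ne_zero.2 h) ?_
    rw [Rat.cast_sub_of_ne_zero (hA 0 0) (hA 1 1), hAr, hAr]
    simp
  have hdet := A.2
  rw [Matrix.det_fin_two] at hdet
  refine ⟨A 0 0, ?_, fun i j => ?_⟩
  · rw [e1, ← e3] at hdet
    linear_combination hdet
  · fin_cases i <;> fin_cases j <;> simp [e1, e2, e3]

theorem isLEF_PSL2Q : IsLEF PSL(2, ℚ) := by
  classical
  intro F
  let o : PSL(2, ℚ) → SL(2, ℚ) := Quotient.out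
  have ho : ∀ g, (QuotientGroup.mk (o g) : PSL(2, ℚ)) = g := fun g => Quotient.out_eq g
  have hden : ∀ g, ∀ᶠ p : ℕ in Filter.atTop, ∀ i j, ((o g i j).den : ZMod p) ≠ 0 := fun g => by
    simp only [Filter.eventually_all]
    exact fun i j => eventually_den_ne_zero _
  have hcast : ∀ x : ℚ, ∀ᶠ p : ℕ in Filter.atTop, ∀ [Fact p.Prime], x ≠ 0 → (x : ZMod p) ≠ 0 :=
    fun x => by
      by_cases hx : x = 0
      · exact Filter.Eventually.of_forall fun p _ h => absurd hx h
      · exact (eventually_ratCast_ne_zero hx).mono fun p h _ _ => h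
  have h1 : ∀ᶠ p : ℕ in Filter.atTop, ∀ g ∈ F, ∀ i j, ((o g i j).den : ZMod p) ≠ 0 :=
    (Filter.eventually_all_finset F).2 fun g _ => hden g
  -- The product `g * h` may lie outside `F`, so the denominators of its representative need
  -- separate control.
  have h2 : ∀ᶠ p : ℕ in Filter.atTop, ∀ g ∈ F, ∀ h ∈ F, ∀ i j,
      ((o (g * h) i j).den : ZMod p) ≠ 0 :=
    (Filter.eventually_all_finset F).2 fun g _ => (Filter.eventually_all_finset F).2 fun h _ =>
      hden (g * h)
  have h3 : ∀ᶠ p : ℕ in Filter.atTop, ∀ g ∈ F, ∀ [Fact p.Prime],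
      (o g 0 1 ≠ 0 → ((o g 0 1 : ℚ) : ZMod p) ≠ 0) ∧
      (o g 1 0 ≠ 0 → ((o g 1 0 : ℚ) : ZMod p) ≠ 0) ∧
      (o g 0 0 - o g 1 1 ≠ 0 → ((o g 0 0 - o g 1 1 : ℚ) : ZMod p) ≠ 0) :=
    (Filter.eventually_all_finset F).2 fun g _ => by
      filter_upwards [hcast (o g 0 1), hcast (o g 1 0), hcast (o g 0 0 - o g 1 1)]
        with p a b c _ using ⟨a, b, c⟩
  obtain ⟨p, hp, h1, h2, h3⟩ :=
    (Nat.frequently_atTop_iff_infinite.2 Nat.infinite_setOfPred_prime |>.and_eventually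
      (h1.and (h2.and h3))).exists
  have : Fact p.Prime := ⟨hp⟩
  refine ⟨PSL(2, ZMod p), inferInstance, inferInstance, fun g =>
    -- The default value `1` is never used on `F` or on products of two elements of `F`.
    if h : ∀ i j, ((o g i j).den : ZMod p) ≠ 0 then QuotientGroup.mk (reduceMod p (o g) h) else 1,
    fun g hg h hh => ?_, fun g hg hg1 => ?_⟩
  · dsimp only
    rw [dif_pos (h1 g hg), dif_pos (h1 h hh), dif_pos (h2 g hg h hh)]
    refine mk_reduceMod_mul _ _ _ ?_
    rw [ho, ho, ho]
  · dsimp only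
    rw [dif_pos (h1 g hg)]
    obtain ⟨a, b, c⟩ := h3 g hg
    exact mk_reduceMod_ne_one _ a b c (by rwa [ho])

end Reduction

/-! ### Reduced products of finite groups. -/

section ReducedProduct

/-- The sequences which are eventually trivial. -/
def eventuallyTrivial (Q : ℕ → Type) [∀ n, Group (Q n)] : Subgroup (∀ n, Q n) where
  carrier := {f | ∀ᶠ n in Filter.atTop, f n = 1}
  mul_mem' := fun hf hg => by
    filter_upwards [hf, hg] with n h1 h2
    rw [Pi.mul_apply, h1, h2, one_mul]
  one_mem' := Filter.Eventually.of_forall fun _ => rfl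
  inv_mem' := fun hf => by
    filter_upwards [hf] with n h
    rw [Pi.inv_apply, h, inv_one]

variable {Q : ℕ → Type} [∀ n, Group (Q n)]

instance : (eventuallyTrivial Q).Normal where
  conj_mem f hf g := by
    filter_upwards [hf] with n h
    rw [Pi.mul_apply, Pi.mul_apply, Pi.inv_apply, h, mul_one, mul_inv_cancel]

lemma reducedProduct_mk_eq_iff (f g : ∀ n, Q n) :
    (QuotientGroup.mk f : (∀ n, Q n) ⧸ eventuallyTrivial Q) = QuotientGroup.mk g ↔
      ∀ᶠ n in Filter.atTop, f n = g n := by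
  rw [QuotientGroup.eq]
  refine Filter.eventually_congr (Filter.Eventually.of_forall fun n => ?_)
  rw [Pi.mul_apply, Pi.inv_apply, inv_mul_eq_one]

/-- The reduced product of a sequence of finite groups is locally embeddable into finite groups. -/
theorem isLEF_reducedProduct [∀ n, Finite (Q n)] :
    IsLEF ((∀ n, Q n) ⧸ eventuallyTrivial Q) := by
  classical
  intro F
  let o : ((∀ n, Q n) ⧸ eventuallyTrivial Q) → ∀ n, Q n := Quotient.out
  have ho : ∀ g, (QuotientGroup.mk (o g) : (∀ n, Q n) ⧸ eventuallyTrivial Q) = g :=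
    fun g => Quotient.out_eq g
  have hmul : ∀ᶠ n in Filter.atTop, ∀ g ∈ F, ∀ h ∈ F, o (g * h) n = o g n * o h n :=
    (Filter.eventually_all_finset F).2 fun g _ => (Filter.eventually_all_finset F).2 fun h _ => by
      refine (reducedProduct_mk_eq_iff (o (g * h)) (o g * o h)).1 ?_
      rw [QuotientGroup.mk_mul, ho, ho, ho]
  obtain ⟨m, hm⟩ := Filter.eventually_atTop.1 hmul
  -- A nontrivial class need not be nontrivial at all large indices, but it is so at arbitrarily
  -- large ones. Different elements may need different indices, so the finite model is a product
  -- over the chosen indices.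
  have hne : ∀ g, ∃ n, m ≤ n ∧ (g ≠ 1 → o g n ≠ 1) := fun g => by
    by_cases hg : g = 1
    · exact ⟨m, le_rfl, fun h => absurd hg h⟩
    · by_contra! hcon
      refine hg ?_
      rw [← ho g, ← QuotientGroup.mk_one, reducedProduct_mk_eq_iff]
      exact Filter.eventually_atTop.2 ⟨m, fun n hn => (hcon n hn).2⟩
  choose ν hν hν1 using hne
  refine ⟨∀ n : F.image ν, Q n, inferInstance, inferInstance, fun g n => o g n,
    fun g hg h hh => ?_, fun g hg hg1 hcon => ?_⟩
  · funext ⟨n, hn⟩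
    obtain ⟨k, hk, rfl⟩ := Finset.mem_image.1 hn
    exact hm _ (hν k) g hg h hh
  · exact hν1 g hg1 (congrFun hcon ⟨ν g, Finset.mem_image_of_mem ν hg⟩)

end ReducedProduct

/-! ### A finitely generated lamp group that is not residually amenable. -/

section Wreath

open scoped MatrixGroups

/-- The action of a group `X` on `X × Fin 3` by left multiplication. -/
def leftMulPerm (X : Type) [Group X] : X →* Equiv.Perm (X × Fin 3) where
  toFun x := Equiv.prodCongr (Equiv.mulLeft x) 1
  map_one' := by ext z <;> simp
  map_mul' x y := by ext z <;> simp [mul_assoc]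

lemma leftMulPerm_apply {X : Type} [Group X] (x : X) (z : X × Fin 3) :
    leftMulPerm X x z = (x * z.1, z.2) := rfl

open scoped Classical in
/-- The permutation of `{1} × Fin 3` given by `σ`. -/
def lamp (X : Type) [Group X] (σ : Equiv.Perm (Fin 3)) : Equiv.Perm (X × Fin 3) :=
  Equiv.Perm.prodExtendRight 1 σ

lemma lamp_apply_one {X : Type} [Group X] (σ : Equiv.Perm (Fin 3)) (i : Fin 3) :
    lamp X σ (1, i) = (1, σ i) := by
  classical
  exact Equiv.Perm.prodExtendRight_apply_eq _ _ _

lemma lamp_apply_ne {X : Type} [Group X] (σ : Equiv.Perm (Fin 3)) (z : X × Fin 3) (hz : z.1 ≠ 1) :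
    lamp X σ z = z := by
  classical
  exact Equiv.Perm.prodExtendRight_apply_ne _ hz _

/-- Conjugation by `x` moves the lamp from the fibre over `1` to the fibre over `x`, so the supports
are disjoint. -/
lemma commute_conj_lamp {X : Type} [Group X] {x : X} (hx : x ≠ 1) (σ τ : Equiv.Perm (Fin 3)) :
    Commute (leftMulPerm X x * lamp X σ * (leftMulPerm X x)⁻¹) (lamp X τ) := by
  refine Equiv.Perm.Disjoint.commute fun z => ?_
  by_cases hz : z.1 = 1
  · left
    rw [Equiv.Perm.mul_apply, Equiv.Perm.mul_apply, ← map_inv, lamp_apply_ne, leftMulPerm_apply,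
      leftMulPerm_apply]
    · simp
    · rw [leftMulPerm_apply, hz]
      simpa using hx
  · exact Or.inr (lamp_apply_ne _ _ hz)

/-- Conjugating by `c` does nothing to words in `a` and `b`. For `c = x * a * x⁻¹` the left side
lies in every normal subgroup containing `x`, while the right side does not involve `x`. -/
lemma conj_commutator_eq {G : Type} [Group G] {a b c : G} (ha : Commute c a) (hb : Commute c b) :
    c * a⁻¹ * b * (c * a⁻¹)⁻¹ * b⁻¹ = a⁻¹ * b * a * b⁻¹ := by
  have h : c * (a⁻¹ * b * a) = a⁻¹ * b * a * c := (ha.inv_right.mul_right hb).mul_right ha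
  calc c * a⁻¹ * b * (c * a⁻¹)⁻¹ * b⁻¹ = c * (a⁻¹ * b * a) * c⁻¹ * b⁻¹ := by group
    _ = _ := by rw [h]; group

/-- The permutations of `SL(2, ℤ/(n+1)) × Fin 3`. -/
abbrev LampPerm (n : ℕ) : Type := Equiv.Perm (SL(2, ZMod (n + 1)) × Fin 3)

/-- The reduced product of the groups `LampPerm n`. -/
abbrev LampProduct : Type := (∀ n, LampPerm n) ⧸ eventuallyTrivial LampPerm

/-- The action of `SL(2, ℤ)` by translation modulo `n + 1`, for all `n`. -/
def translateSL2Z : SL(2, ℤ) →* LampProduct :=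
  (QuotientGroup.mk' (eventuallyTrivial LampPerm)).comp
    (MonoidHom.pi fun n => (leftMulPerm _).comp
      (Matrix.SpecialLinearGroup.map (Int.castRingHom (ZMod (n + 1)))))

/-- The lamp permutation at the identity, for all `n`. -/
def lampClass (σ : Equiv.Perm (Fin 3)) : LampProduct :=
  QuotientGroup.mk fun _ => lamp _ σ

/-- Some entry of `A` differs from that of the identity by a nonzero integer, which only finitely
many moduli kill. The modulus `n + 1` avoids `ZMod 0 = ℤ` and keeps all the groups finite. -/
lemma eventually_map_ne_one {A : SL(2, ℤ)} (hA : A ≠ 1) : ∀ᶠ n : ℕ in Filter.atTop,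
    Matrix.SpecialLinearGroup.map (Int.castRingHom (ZMod (n + 1))) A ≠ 1 := by
  obtain ⟨i, j, hij⟩ : ∃ i j, A i j ≠ (1 : SL(2, ℤ)) i j := by
    by_contra! h
    exact hA (Matrix.SpecialLinearGroup.ext _ _ h)
  filter_upwards [(Filter.tendsto_add_atTop_nat 1).eventually
    (eventually_intCast_ne_zero (sub_ne_zero.2 hij))] with n hn h
  refine hn ?_
  rw [← map_one (Matrix.SpecialLinearGroup.map (Int.castRingHom (ZMod (n + 1))))] at h
  have := congrArg (fun B : SL(2, ZMod (n + 1)) => B i j) h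
  rw [Int.cast_sub, sub_eq_zero]
  exact this

lemma lampClass_conj_commutator {A : SL(2, ℤ)} (hA : A ≠ 1) (σ τ : Equiv.Perm (Fin 3)) :
    translateSL2Z A * lampClass σ * (translateSL2Z A)⁻¹ * (lampClass σ)⁻¹ * lampClass τ *
      (translateSL2Z A * lampClass σ * (translateSL2Z A)⁻¹ * (lampClass σ)⁻¹)⁻¹ *
      (lampClass τ)⁻¹ = (lampClass σ)⁻¹ * lampClass τ * lampClass σ * (lampClass τ)⁻¹ := by
  refine (reducedProduct_mk_eq_iff (Q := LampPerm) _ _).2 ?_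
  filter_upwards [eventually_map_ne_one hA] with n hn
  exact conj_commutator_eq (commute_conj_lamp hn σ σ) (commute_conj_lamp hn σ τ)

/-- At any index the lamps act on the fibre over `1` as `σ` and `τ` themselves, so a trivial
commutator of lamps would make `σ` and `τ` commute. -/
lemma lampClass_commutator_ne_one {σ τ : Equiv.Perm (Fin 3)} (h : σ⁻¹ * τ * σ * τ⁻¹ ≠ 1) :
    (lampClass σ)⁻¹ * lampClass τ * lampClass σ * (lampClass τ)⁻¹ ≠ 1 := by
  intro h1
  refine h ?_
  obtain ⟨n, hn⟩ := ((reducedProduct_mk_eq_iff (Q := LampPerm) _ 1).1 h1).exists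
  have hn' : lamp SL(2, ZMod (n + 1)) τ * lamp _ σ = lamp _ σ * lamp _ τ := by
    have h2 : (lamp SL(2, ZMod (n + 1)) σ)⁻¹ * lamp _ τ * lamp _ σ * (lamp _ τ)⁻¹ = 1 := hn
    rwa [mul_inv_eq_one, mul_assoc, inv_mul_eq_iff_eq_mul] at h2
  rw [mul_inv_eq_one, mul_assoc, inv_mul_eq_iff_eq_mul]
  ext i : 1
  have h3 := congrArg (fun e : Equiv.Perm (SL(2, ZMod (n + 1)) × Fin 3) => (e (1, i)).2) hn'
  simpa only [Equiv.Perm.mul_apply, lamp_apply_one] using h3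

/-- The group generated by the translations by `SL(2, ℤ)` and two lamps. -/
def lampGroup (σ τ : Equiv.Perm (Fin 3)) : Subgroup LampProduct :=
  Subgroup.closure {translateSL2Z ModularGroup.S, translateSL2Z ModularGroup.T, lampClass σ,
    lampClass τ}

lemma translateSL2Z_mem_lampGroup (σ τ : Equiv.Perm (Fin 3)) (A : SL(2, ℤ)) :
    translateSL2Z A ∈ lampGroup σ τ := by
  have hle : Subgroup.closure {ModularGroup.S, ModularGroup.T} ≤
      (lampGroup σ τ).comap translateSL2Z := by
    rw [Subgroup.closure_le]
    rintro _ (rfl | rfl) <;> exact Subgroup.subset_closure (by simp)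
  rw [SpecialLinearGroup.SL2Z_generators] at hle
  exact hle (Subgroup.mem_top A)

/-- If `N` contains the image of some `A ≠ 1`, it contains the commutator of that image with `a`,
hence by `lampClass_conj_commutator` also the commutator of lamps. An `N` that misses the latter
thus meets the image of `SL(2, ℤ)` trivially, and `SL(2, ℤ)` embeds in the quotient. -/
lemma not_isResiduallyAmenable_lampGroup {σ τ : Equiv.Perm (Fin 3)}
    (h : σ⁻¹ * τ * σ * τ⁻¹ ≠ 1) : ¬ IsResiduallyAmenable (lampGroup σ τ) := by
  intro hres
  let a : lampGroup σ τ := ⟨lampClass σ, Subgroup.subset_closure (by simp)⟩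
  let b : lampGroup σ τ := ⟨lampClass τ, Subgroup.subset_closure (by simp)⟩
  let ψ : SL(2, ℤ) →* lampGroup σ τ :=
    translateSL2Z.codRestrict _ (translateSL2Z_mem_lampGroup σ τ)
  obtain ⟨N, _, hN, hamen⟩ := hres (a⁻¹ * b * a * b⁻¹)
    fun h1 => lampClass_commutator_ne_one h (congrArg Subtype.val h1)
  refine not_isAmenableGroup_SL2Z (hamen.of_injective ((QuotientGroup.mk' N).comp ψ) ?_)
  rw [injective_iff_map_eq_one]
  intro A hA
  by_contra hA1
  have hAN : ψ A ∈ N := (QuotientGroup.eq_one_iff _).1 hA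
  refine hN ?_
  have heq : ψ A * a * (ψ A)⁻¹ * a⁻¹ * b * (ψ A * a * (ψ A)⁻¹ * a⁻¹)⁻¹ * b⁻¹ =
      a⁻¹ * b * a * b⁻¹ := Subtype.ext (lampClass_conj_commutator hA1 σ τ)
  have h1 : ψ A * a * (ψ A)⁻¹ * a⁻¹ ∈ N := by
    have := N.mul_mem hAN (‹N.Normal›.conj_mem _ (N.inv_mem hAN) a)
    simpa [mul_assoc] using this
  rw [← heq]
  have := N.mul_mem h1 (‹N.Normal›.conj_mem _ (N.inv_mem h1) b)
  simpa [mul_assoc] using this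

end Wreath

lemma countable_of_fg (G : Type) [Group G] [h : Group.FG G] : Countable G := by
  obtain ⟨S, hS, f, hf⟩ := Group.fg_iff_exists_freeGroup_hom_surjective.1 h
  have := hS.countable.to_subtype
  have : Countable (FreeGroup S) := Function.Surjective.countable Quot.mk_surjective
  exact hf.countable

theorem corollary3p2 :
    (∃ (G : Type) (_ : Group G),
      Countable G ∧ IsSimpleGroup G ∧ ¬ IsAmenableGroup G ∧ IsHyperlinear G) ∧
    (∃ (G : Type) (_ : Group G),
      Group.FG G ∧ ¬ IsResiduallyAmenable G ∧ IsHyperlinear G) := by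
  constructor
  · have : Countable (Matrix (Fin 2) (Fin 2) ℚ) := inferInstanceAs (Countable (Fin 2 → Fin 2 → ℚ))
    have : Countable (Matrix.SpecialLinearGroup (Fin 2) ℚ) := Subtype.countable
    have hc : Countable (Matrix.ProjectiveSpecialLinearGroup (Fin 2) ℚ) :=
      Quotient.countable
    exact ⟨Matrix.ProjectiveSpecialLinearGroup (Fin 2) ℚ, inferInstance, hc,
      Matrix.ProjectiveSpecialLinearGroup.rank_two_simple' ⟨2, by norm_num, by norm_num⟩,
      not_isAmenableGroup_PSL, isLEF_PSL2Q.isHyperlinear⟩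
  -- Any two non-commuting permutations would serve as lamps.
  · let σ : Equiv.Perm (Fin 3) := Equiv.swap 0 1
    let τ : Equiv.Perm (Fin 3) := Equiv.swap 1 2
    have hfg : Group.FG (lampGroup σ τ) :=
      (Group.fg_iff_subgroup_fg _).2 ((Subgroup.fg_iff _).2 ⟨_, rfl, by simp⟩)
    have : Countable (lampGroup σ τ) := countable_of_fg _
    exact ⟨lampGroup σ τ, inferInstance, hfg,
      not_isResiduallyAmenable_lampGroup (by decide),
      (isLEF_reducedProduct.of_injective (lampGroup σ τ).subtype
        Subtype.val_injective).isHyperlinear⟩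

end
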